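/- A hypergraph is a pair $H=(V,E)$ with $V$ a non-empty finite set and $E$ a finite multiset of subsets of $V$; throughout, $H$ is assumed to have no empty edges. A walk is an alternating sequence $v_0e_1v_1\ldots e_kv_k$ of vertices and edges with $v_{i-1}\neq v_i$ and $v_{i-1},v_i\in e_i$ for all $i$; it is closed if $v_0=v_k$ and $k\ge 2$. A spanning Euler tour of $H$ is a closed walk that traverses every edge of $H$ (counted with multiplicity) exactly once and in which every vertex of $H$ occurs as some $v_i$. $H$ is connected if any two of its vertices are joined by a walk. For $S\subseteq V$, $H\backslash S$ is the hypergraph obtained from $H$ by deleting the vertices of $S$ from $V$ and from each edge, and then deleting all empty edges. A subhypergraph of $(V,E)$ is a hypergraph $(V',E')$ such that $V'\subseteq V$ and $E'$ is the multiset of the intersections $e\cap V'$, $e\in E''$, for some submultiset $E''$ of $E$; the connected components of a hypergraph are its maximal connected subhypergraphs without empty edges. A 2-vertex cut of $H$ is a set $S\subsetneq V$ with $|S|=2$ such that $H\backslash S$ is disconnected. Theorem. Let $H=(V,E)$ be a hypergraph without empty edges, with a 2-vertex cut $S=\{u,v\}$, and assume that the number of edges $e\in E$ (counted with multiplicity)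 with $e=S$ is even. Let $H_1,\ldots,H_k$ be the connected components of $H\backslash S$. For each $i$, let $H_i'$ be the hypergraph with vertex set $V(H_i)\cup S$ whose edges are all the non-empty edges $e\in E$ (with multiplicity) such that $e\subseteq V(H_i)\cup S$; let $H_i^{\ast}$ and $H_i^{\ast\ast}$ be obtained from $H_i'$ by adjoining one and two additional copies of the edge $S$, respectively. Then $H$ admits a spanning Euler tour if and only if there exists a subset $I\subseteq\{1,\ldots,k\}$ of even size such that (1) $H_i^{\ast}$ admits a spanning Euler tour for each $i\in I$; (2) for each $i\notin I$, at least one of $H_i'$ and $H_i^{\ast\ast}$ admits a spanning Euler tour; and (3) if $I=\emptyset$, then $H_i'$ admits a spanning Euler tour for some $i$. -/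

import Mathlib

/-- A (finite) hypergraph with multiple edges allowed: a finite vertex set together with a finite
multiset of subsets of it. Non-emptiness of the vertex set is not built in, so that deleting
vertices is a total operation. -/
@[ext] structure MultiHypergraph (α : Type*) where
  verts : Finset α
  edges : Multiset (Finset α)
  subset_verts : ∀ e ∈ edges, e ⊆ verts

namespace MultiHypergraph

variable {α : Type*}

/-- `x` and `y` are adjacent via the edge `e`; adjacent vertices are distinct. -/
def AdjVia (H : MultiHypergraph α) (x y : α) (e : Finset α) : Prop :=
  e ∈ H.edges ∧ x ≠ y ∧ x ∈ e ∧ y ∈ e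

/-- An `(x, y)`-walk: an alternating sequence of vertices and edges in which consecutive vertices
are adjacent via the edge between them. -/
inductive Walk (H : MultiHypergraph α) : α → α → Type _
  | nil (x : α) (hx : x ∈ H.verts) : Walk H x x
  | cons {x y z : α} (e : Finset α) (h : H.AdjVia x y e) (W : Walk H y z) : Walk H x z

namespace Walk

/-- The sequence of anchors `v₀, v₁, …, v_k` of a walk. -/
def anchors {H : MultiHypergraph α} : {x y : α} → H.Walk x y → List α
  | _, _, .nil x _ => [x]
  | _, _, .cons (x := x) _ _ W => x :: W.anchors

/-- The sequence of edges `e₁, …, e_k` of a walk. -/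
def edgeList {H : MultiHypergraph α} : {x y : α} → H.Walk x y → List (Finset α)
  | _, _, .nil _ _ => []
  | _, _, .cons e _ W => e :: W.edgeList

/-- The length of a walk, that is, its number of edges. -/
def length {H : MultiHypergraph α} {x y : α} (W : H.Walk x y) : ℕ :=
  W.edgeList.length

/-- A (strict) trail: the edges of the walk are pairwise distinct members of the multiset of edges
of `H`, that is, every set occurs in the walk at most as often as it occurs as an edge of `H`. -/
def IsTrail {H : MultiHypergraph α} {x y : α} (W : H.Walk x y) : Prop :=
  (W.edgeList : Multiset (Finset α)) ≤ H.edges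

/-- An Euler tour: a closed trail (of length at least 2) that traverses every edge of `H`,
every copy of a multiple edge included. -/
def IsEulerTour {H : MultiHypergraph α} {x : α} (W : H.Walk x x) : Prop :=
  2 ≤ W.length ∧ W.IsTrail ∧ H.edges ≤ (W.edgeList : Multiset (Finset α))

/-- A spanning Euler tour: an Euler tour of which every vertex of `H` is an anchor. -/
def IsSpanningEulerTour {H : MultiHypergraph α} {x : α} (W : H.Walk x x) : Prop :=
  W.IsEulerTour ∧ ∀ y ∈ H.verts, y ∈ W.anchors

end Walk

/-- `H` admits a spanning Euler tour. -/
def HasSpanningEulerTour (H : MultiHypergraph α) : Prop :=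
  ∃ (x : α) (W : H.Walk x x), W.IsSpanningEulerTour

/-- `H` is connected: any two vertices are joined by a walk. -/
def IsConnected (H : MultiHypergraph α) : Prop :=
  ∀ x ∈ H.verts, ∀ y ∈ H.verts, Nonempty (H.Walk x y)

variable [DecidableEq α]

/-- `K` is a subhypergraph of `H`: its vertices are vertices of `H`, and its edges are the traces on
its vertex set of the members of some submultiset of the edges of `H`. -/
def IsSubhypergraph (K H : MultiHypergraph α) : Prop :=
  K.verts ⊆ H.verts ∧ ∃ E' ≤ H.edges, K.edges = E'.map (fun e => e ∩ K.verts)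

/-- `F` is a connected component of `H`: a maximal connected subhypergraph of `H` without empty
edges. -/
def IsComponent (F H : MultiHypergraph α) : Prop :=
  (F.IsSubhypergraph H ∧ F.IsConnected ∧ ∅ ∉ F.edges) ∧
    ∀ K : MultiHypergraph α, K.IsSubhypergraph H → K.IsConnected → ∅ ∉ K.edges →
      F.IsSubhypergraph K → K = F

/-- The hypergraph obtained from `H` by deleting the vertices in `S` from the vertex set and from
each edge, and subsequently deleting all empty edges; that is, the subhypergraph of `H` induced by
the vertices outside `S`. -/
def delete (H : MultiHypergraph α) (S : Finset α) : MultiHypergraph α where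
  verts := H.verts \ S
  edges := (H.edges.map (fun e => e \ S)).filter (fun e => e ≠ ∅)
  subset_verts := by
    intro e he
    obtain ⟨e', he', rfl⟩ := Multiset.mem_map.1 (Multiset.mem_filter.1 he).1
    exact Finset.sdiff_subset_sdiff (H.subset_verts e' he') (Finset.Subset.refl S)

/-- `S` is a vertex cut of `H`: a proper subset of the vertex set whose deletion leaves a
disconnected hypergraph. -/
def IsVertexCut (H : MultiHypergraph α) (S : Finset α) : Prop :=
  S ⊂ H.verts ∧ ¬ (H.delete S).IsConnected

/-- The hypergraph obtained from `H` by adjoining `n` copies of the edge `S`. -/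
def adjoin (H : MultiHypergraph α) (S : Finset α) (n : ℕ) (hS : S ⊆ H.verts) :
    MultiHypergraph α where
  verts := H.verts
  edges := H.edges + Multiset.replicate n S
  subset_verts := by
    intro e he
    rcases Multiset.mem_add.1 he with h | h
    · exact H.subset_verts e h
    · rw [Multiset.eq_of_mem_replicate h]
      exact hS

/-- The `S`-component `F'` of `H` corresponding to a connected component `F` of `H \ S`: its vertex
set is `V(F) ∪ S`, and its edges are the non-empty edges of `H` contained in `V(F) ∪ S`. -/
def sComponent (H : MultiHypergraph α) (S : Finset α) (F : MultiHypergraph α) :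
    MultiHypergraph α where
  verts := F.verts ∪ S
  edges := H.edges.filter (fun e => e ⊆ F.verts ∪ S ∧ e ≠ ∅)
  subset_verts := fun _ he => (Multiset.mem_filter.1 he).2.1

/-- The `S*`-component `F*`: the `S`-component with `|S| / 2` additional copies of the edge `S`
(meant for `|S|` even). -/
def sStarComponent (H : MultiHypergraph α) (S : Finset α) (F : MultiHypergraph α) :
    MultiHypergraph α :=
  (H.sComponent S F).adjoin S (S.card / 2) Finset.subset_union_right

/-- The `S**`-component `F**`: the `S`-component with two additional copies of the edge `S`. -/
def sStarStarComponent (H : MultiHypergraph α) (S : Finset α) (F : MultiHypergraph α) :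
    MultiHypergraph α :=
  (H.sComponent S F).adjoin S 2 Finset.subset_union_right

end MultiHypergraph

/-! ### Connected components as reachability classes. -/

namespace MultiHypergraph

variable {α : Type*}

/-! A spanning Euler tour amounts to marking, in every copy of an edge, a pair of distinct vertices
so that the marked pairs form a multigraph with even degrees that is connected on the whole vertex
set. This is Euler's theorem (`Trail.exists_euler`, `hasSpanningEulerTour_iff_marking`), and it
turns the problem into one of parity and connectivity.

A copy of `S = {u, v}` can only be marked by `uv`, so only the number `m` of copies matters
(`hasSpanningEulerTour_iff_splitting`). A singleton edge cannot be marked at all. Every other edge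
meets exactly one component of `H \ S`, so a marking is a family of independent markings of the
pieces `V_i ∪ S` (`exists_splitting_iff`). In each piece the degrees away from `u` and `v` are even,
so by the handshake lemma those at `u` and `v` have equal parity. The set `I` collects the pieces
where it is odd: one extra copy of `S` repairs these. In an even piece two extra copies always
repair connectivity, and none is needed if `u` and `v` are already joined there or `m > 0`. As `m`
is even, the degree at `u` is even exactly when `|I|` is. Finally, `u` and `v` must be joined
somewhere: an odd piece joins them by the handshake lemma, and for `I = ∅` this is condition (3). -/

theorem Walk.end_mem {G : MultiHypergraph α} {x y : α} (W : G.Walk x y) : y ∈ G.verts := by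
  induction W with
  | nil _ hx => exact hx
  | cons _ _ _ ih => exact ih

/-- `y` can be reached from `x` by a walk. -/
def Reachable (G : MultiHypergraph α) (x y : α) : Prop := Nonempty (G.Walk x y)

namespace Reachable

variable {G : MultiHypergraph α} {x y z : α}

theorem trans (h : G.Reachable x y) (h' : G.Reachable y z) : G.Reachable x z := by
  obtain ⟨W⟩ := h
  induction W with
  | nil => exact h'
  | cons e he _ ih => exact ⟨.cons e he (ih h').some⟩

theorem of_mem_edge {e : Finset α} (he : e ∈ G.edges) (hx : x ∈ e) (hy : y ∈ e) :
    G.Reachable x y := by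
  by_cases hxy : x = y
  · subst hxy
    exact ⟨.nil x (G.subset_verts e he hx)⟩
  · exact ⟨.cons e ⟨he, hxy, hx, hy⟩ (.nil y (G.subset_verts e he hy))⟩

theorem symm (h : G.Reachable x y) : G.Reachable y x := by
  obtain ⟨W⟩ := h
  induction W with
  | nil x hx => exact ⟨.nil x hx⟩
  | cons e he _ ih => exact ih.trans (of_mem_edge he.1 he.2.2.2 he.2.2.1)

end Reachable

open Classical in
/-- The hypergraph induced on the set of vertices reachable from `x`. -/
noncomputable def componentOf (G : MultiHypergraph α) (x : α) : MultiHypergraph α where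
  verts := G.verts.filter (G.Reachable x)
  edges := G.edges.filter (fun e => e ⊆ G.verts.filter (G.Reachable x))
  subset_verts := fun _ he => (Multiset.mem_filter.1 he).2

theorem mem_componentOf_verts {G : MultiHypergraph α} {x y : α} :
    y ∈ (G.componentOf x).verts ↔ G.Reachable x y := by
  simp only [componentOf, Finset.mem_filter, and_iff_right_iff_imp]
  exact fun ⟨W⟩ => W.end_mem

theorem subset_componentOf_of_mem_edge {G : MultiHypergraph α} {x y : α} {e : Finset α}
    (he : e ∈ G.edges) (hy : y ∈ e) (hxy : G.Reachable x y) : e ⊆ (G.componentOf x).verts :=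
  fun _ hz => mem_componentOf_verts.2 (hxy.trans (.of_mem_edge he hy hz))

theorem mem_componentOf_edges {G : MultiHypergraph α} {x : α} {e : Finset α} :
    e ∈ (G.componentOf x).edges ↔ e ∈ G.edges ∧ e ⊆ (G.componentOf x).verts := by
  simp [componentOf]

theorem le_componentOf_edges {G : MultiHypergraph α} {x : α} {E : Multiset (Finset α)} :
    E ≤ (G.componentOf x).edges ↔ E ≤ G.edges ∧ ∀ e ∈ E, e ⊆ (G.componentOf x).verts := by
  classical
  exact Multiset.le_filter

theorem componentOf_isConnected (G : MultiHypergraph α) (x : α) :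
    (G.componentOf x).IsConnected := by
  intro y hy z hz
  rw [mem_componentOf_verts] at hy hz
  obtain ⟨W⟩ := hy.symm.trans hz
  induction W with
  | nil w _ => exact ⟨.nil w (mem_componentOf_verts.2 hy)⟩
  | @cons a b _ e he _ ih =>
    have hb : G.Reachable x b := hy.trans (.of_mem_edge he.1 he.2.2.1 he.2.2.2)
    exact ⟨.cons e ⟨mem_componentOf_edges.2
      ⟨he.1, subset_componentOf_of_mem_edge he.1 he.2.2.1 hy⟩, he.2⟩ (ih hb hz).some⟩

variable [DecidableEq α]

theorem map_inter_eq_self {E : Multiset (Finset α)} {A : Finset α} (h : ∀ e ∈ E, e ⊆ A) :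
    E.map (fun e => e ∩ A) = E := by
  conv_rhs => rw [← Multiset.map_id E]
  exact Multiset.map_congr rfl fun e he => Finset.inter_eq_left.2 (h e he)

/-- With no vertices lost, taking traces changes nothing; this makes the subhypergraph relation
antisymmetric. -/
theorem IsSubhypergraph.edges_le {K L : MultiHypergraph α} (h : K.IsSubhypergraph L)
    (hv : L.verts ⊆ K.verts) : K.edges ≤ L.edges := by
  obtain ⟨-, E, hE, hK⟩ := h
  rw [hK, map_inter_eq_self]
  · exact hE
  · exact fun e he => (L.subset_verts e (Multiset.mem_of_le hE he)).trans hv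

theorem IsSubhypergraph.antisymm {K L : MultiHypergraph α} (h : K.IsSubhypergraph L)
    (h' : L.IsSubhypergraph K) : K = L :=
  MultiHypergraph.ext (h.1.antisymm h'.1) (le_antisymm (h.edges_le h'.1) (h'.edges_le h.1))

theorem IsSubhypergraph.reachable {K G : MultiHypergraph α} (h : K.IsSubhypergraph G) {x y : α}
    (hxy : K.Reachable x y) : G.Reachable x y := by
  obtain ⟨W⟩ := hxy
  obtain ⟨hv, E, hE, hK⟩ := h
  induction W with
  | nil x hx => exact ⟨.nil x (hv hx)⟩
  | cons e he _ ih =>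
    obtain ⟨he, -, hx, hy⟩ := he
    rw [hK] at he
    obtain ⟨e', he', rfl⟩ := Multiset.mem_map.1 he
    exact (Reachable.of_mem_edge (Multiset.mem_of_le hE he') (Finset.mem_inter.1 hx).1
      (Finset.mem_inter.1 hy).1).trans ih

theorem componentOf_isSubhypergraph (G : MultiHypergraph α) (x : α) :
    (G.componentOf x).IsSubhypergraph G := by
  refine ⟨fun _ hy => (mem_componentOf_verts.1 hy).elim Walk.end_mem, _, (le_componentOf_edges.1 le_rfl).1,
    (map_inter_eq_self (E := (G.componentOf x).edges) fun e he => ?_).symm⟩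
  exact (mem_componentOf_edges.1 he).2

/-- A non-empty trace meets `K`, so the edge it comes from lies wholly in the reachability class. An
empty trace could come from an edge elsewhere. -/
theorem IsSubhypergraph.componentOf {K G : MultiHypergraph α} (h : K.IsSubhypergraph G)
    (hc : K.IsConnected) (hempty : ∅ ∉ K.edges) {x : α} (hx : x ∈ K.verts) :
    K.IsSubhypergraph (G.componentOf x) := by
  refine ⟨fun y hy => mem_componentOf_verts.2 (h.reachable (hc x hx y hy)), ?_⟩
  obtain ⟨hv, E, hE, hK⟩ := id h
  refine ⟨E, le_componentOf_edges.2 ⟨hE, fun e he => ?_⟩, hK⟩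
  have hne : (e ∩ K.verts).Nonempty := by
    rw [Finset.nonempty_iff_ne_empty]
    intro h0
    exact hempty (hK ▸ Multiset.mem_map.2 ⟨e, he, h0⟩)
  obtain ⟨y, hy⟩ := hne
  rw [Finset.mem_inter] at hy
  exact subset_componentOf_of_mem_edge (Multiset.mem_of_le hE he) hy.1
    (h.reachable (hc x hx y hy.2))

theorem componentOf_isComponent {G : MultiHypergraph α} (hempty : ∅ ∉ G.edges) {x : α}
    (hx : x ∈ G.verts) : (G.componentOf x).IsComponent G := by
  refine ⟨⟨G.componentOf_isSubhypergraph x, G.componentOf_isConnected x,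
    fun h => hempty (mem_componentOf_edges.1 h).1⟩, fun K hK hc hne hle => ?_⟩
  have hxK : x ∈ K.verts := hle.1 (mem_componentOf_verts.2 ⟨.nil x hx⟩)
  exact (hK.componentOf hc hne hxK).antisymm hle

theorem IsComponent.eq_componentOf {F G : MultiHypergraph α} (hF : F.IsComponent G)
    (hempty : ∅ ∉ G.edges) {x : α} (hx : x ∈ F.verts) : F = G.componentOf x :=
  (hF.2 _ (G.componentOf_isSubhypergraph x) (G.componentOf_isConnected x)
    (fun h => hempty (mem_componentOf_edges.1 h).1)
    (hF.1.1.componentOf hF.1.2.1 hF.1.2.2 hx)).symm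

end MultiHypergraph

/-! ### Marked edges, trails and parity of degrees. -/

namespace MultiHypergraph

variable {α : Type*}

/-- `X` is a union of connected components of the multigraph formed by the chosen pairs. -/
def IsClosedUnder (X : Set α) (P : Multiset (Finset α × Sym2 α)) : Prop :=
  ∀ q ∈ P, ∀ x ∈ q.2, x ∈ X → ∀ y ∈ q.2, y ∈ X

/-- The chosen pairs consist of two distinct vertices of the edge. -/
def IsMarking (P : Multiset (Finset α × Sym2 α)) : Prop :=
  ∀ q ∈ P, ¬ q.2.IsDiag ∧ ∀ x ∈ q.2, x ∈ q.1

theorem IsClosedUnder.mono {X : Set α} {P Q : Multiset (Finset α × Sym2 α)}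
    (h : IsClosedUnder X Q) (hPQ : ∀ q ∈ P, q ∈ Q) : IsClosedUnder X P :=
  fun q hq => h q (hPQ q hq)

theorem IsMarking.mono {P Q : Multiset (Finset α × Sym2 α)} (hP : IsMarking P)
    (h : ∀ q ∈ Q, q ∈ P) : IsMarking Q := fun q hq => hP q (h q hq)

/-- The marked edges in `P` can be arranged to form a trail from `a` to `b`. -/
inductive Trail : Multiset (Finset α × Sym2 α) → α → α → Prop
  | nil (a : α) : Trail 0 a a
  | cons {P : Multiset (Finset α × Sym2 α)} {a b c : α} (e : Finset α) (hab : a ≠ b)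
      (h : Trail P b c) : Trail ((e, s(a, b)) ::ₘ P) a c

theorem Trail.append {P Q : Multiset (Finset α × Sym2 α)} {a b c : α} (h : Trail P a b) (h' : Trail Q b c) : Trail (P + Q) a c := by
  induction h with
  | nil => simpa using h'
  | cons e hab _ ih => rw [Multiset.cons_add]; exact cons e hab (ih h')

theorem Trail.single {a b : α} (e : Finset α) (hab : a ≠ b) : Trail {(e, s(a, b))} a b := cons e hab (nil b)

theorem Trail.exists_walk {P : Multiset (Finset α × Sym2 α)} {a b : α} {H : MultiHypergraph α}
    (h : Trail P a b) (ha : a ∈ H.verts)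
    (hP : IsMarking P) (hE : ∀ q ∈ P, q.1 ∈ H.edges) :
    ∃ W : H.Walk a b, (W.edgeList : Multiset (Finset α)) = P.map Prod.fst ∧ a ∈ W.anchors ∧
      ∀ q ∈ P, ∀ w ∈ q.2, w ∈ W.anchors := by
  induction h with
  | nil a => exact ⟨.nil a ha, by simp [Walk.edgeList, Walk.anchors]⟩
  | @cons P a b c e hab h ih =>
    have he := hE _ (Multiset.mem_cons_self _ P)
    have hin := (hP _ (Multiset.mem_cons_self _ P)).2
    have hae : a ∈ e := hin a (Sym2.mem_mk_left a b)
    have hbe : b ∈ e := hin b (Sym2.mem_mk_right a b)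
    obtain ⟨W, h1, h2, h3⟩ := ih (H.subset_verts e he hbe)
      (fun q hq => hP q (Multiset.mem_cons_of_mem hq))
      (fun q hq => hE q (Multiset.mem_cons_of_mem hq))
    refine ⟨.cons e ⟨he, hab, hae, hbe⟩ W, ?_, ?_, ?_⟩
    · rw [Multiset.map_cons, ← h1]; rfl
    · simp [Walk.anchors]
    · intro q hq w hw
      refine List.mem_cons.2 ?_
      rcases Multiset.mem_cons.1 hq with rfl | hq
      · rcases Sym2.mem_iff.1 hw with rfl | rfl
        · exact Or.inl rfl
        · exact Or.inr h2
      · exact Or.inr (h3 q hq w hw)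

/-- Mark each traversed edge by its two consecutive anchors. The last clause encodes connectivity: a
closed set contains all anchors or none. -/
theorem Walk.exists_trail {H : MultiHypergraph α} {x y : α} (W : H.Walk x y) :
    ∃ P, Trail P x y ∧ P.map Prod.fst = (W.edgeList : Multiset (Finset α)) ∧ IsMarking P ∧
      ∀ X : Set α, IsClosedUnder X P → ∀ w ∈ W.anchors, (w ∈ X ↔ x ∈ X) := by
  induction W with
  | nil x hx => exact ⟨0, .nil x, rfl, by simp [IsMarking], by simp [Walk.anchors]⟩
  | @cons x y z e he W ih =>
    obtain ⟨P, hT, hm, hP, hX⟩ := ih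
    refine ⟨(e, s(x, y)) ::ₘ P, .cons e he.2.1 hT, ?_, ?_, ?_⟩
    · rw [Multiset.map_cons, hm]; rfl
    · intro q hq
      rcases Multiset.mem_cons.1 hq with rfl | hq
      · refine ⟨by simpa using he.2.1, fun w hw => ?_⟩
        rcases Sym2.mem_iff.1 hw with rfl | rfl
        exacts [he.2.2.1, he.2.2.2]
      · exact hP q hq
    · intro X hX' w hw
      have hxy := hX' _ (Multiset.mem_cons_self _ P)
      have : x ∈ X ↔ y ∈ X := ⟨fun h => hxy x (Sym2.mem_mk_left x y) h y (Sym2.mem_mk_right x y),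
        fun h => hxy y (Sym2.mem_mk_right x y) h x (Sym2.mem_mk_left x y)⟩
      rw [Walk.anchors, List.mem_cons] at hw
      rcases hw with rfl | hw
      · rfl
      · rw [this]
        exact hX X (hX'.mono fun r hr => Multiset.mem_cons_of_mem hr) w hw

variable [DecidableEq α]

/-- The number of members of a multiset of marked edges (an edge with a chosen pair of its
vertices) whose chosen pair contains `w`. -/
def degree (P : Multiset (Finset α × Sym2 α)) (w : α) : ℕ := P.countP (fun q => w ∈ q.2)

theorem degree_add (P Q : Multiset (Finset α × Sym2 α)) (w : α) :
    degree (P + Q) w = degree P w + degree Q w := Multiset.countP_add _ _ _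

theorem degree_sum {ι : Type*} (s : Finset ι) (P : ι → Multiset (Finset α × Sym2 α)) (w : α) :
    degree (∑ i ∈ s, P i) w = ∑ i ∈ s, degree (P i) w := by
  classical
  induction s using Finset.induction_on with
  | empty => simp [degree]
  | insert a s ha ih => rw [Finset.sum_insert ha, Finset.sum_insert ha, degree_add, ih]

theorem degree_cons (q : Finset α × Sym2 α) (P : Multiset (Finset α × Sym2 α)) (w : α) :
    degree (q ::ₘ P) w = degree P w + if w ∈ q.2 then 1 else 0 := Multiset.countP_cons _ _ _

theorem degree_eq_zero {P : Multiset (Finset α × Sym2 α)} {w : α} (h : ∀ q ∈ P, w ∉ q.2) :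
    degree P w = 0 := Multiset.countP_eq_zero.2 h

/-- The handshake lemma for a union of connected components. -/
theorem even_sum_degree {P : Multiset (Finset α × Sym2 α)} {A : Finset α}
    (hP : IsMarking P) (hA : IsClosedUnder (A : Set α) P) : Even (∑ w ∈ A, degree P w) := by
  induction P using Multiset.induction_on with
  | empty => simp [degree]
  | cons q P ih =>
    have ih' := ih (fun r hr => hP r (Multiset.mem_cons_of_mem hr))
      (hA.mono fun r hr => Multiset.mem_cons_of_mem hr)
    simp only [degree_cons, Finset.sum_add_distrib]
    refine ih'.add ?_
    obtain ⟨hd, -⟩ := hP q (Multiset.mem_cons_self q P)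
    have hq := hA q (Multiset.mem_cons_self q P)
    obtain ⟨e, s⟩ := q
    induction s using Sym2.ind with
    | _ x y =>
      simp only [Sym2.mk_isDiag_iff] at hd
      have h1 := hq x (Sym2.mem_mk_left x y)
      have h2 := hq y (Sym2.mem_mk_right x y)
      simp only [Sym2.mem_iff, Finset.mem_coe] at h1 h2 ⊢
      -- Closedness puts both ends of the pair in `A` or neither, so it contributes 2 or 0.
      by_cases hx : x ∈ A
      · have hy : y ∈ A := h1 hx y (Or.inr rfl)
        have : A.filter (fun w => w = x ∨ w = y) = {x, y} := by
          ext w; simp only [Finset.mem_filter, Finset.mem_insert, Finset.mem_singleton]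
          constructor
          · exact fun h => h.2
          · rintro (rfl | rfl) <;> simp [*]
        rw [← Finset.sum_filter, this, Finset.sum_pair hd]
        exact ⟨1, rfl⟩
      · have hy : y ∉ A := fun hy => hx (h2 hy x (Or.inl rfl))
        rw [Finset.sum_eq_zero]
        · exact Even.zero
        · intro w hw
          rw [if_neg]
          rintro (rfl | rfl) <;> contradiction

/-! ### Euler's theorem for marked edges. -/

namespace Trail

variable {P : Multiset (Finset α × Sym2 α)} {a b : α}

theorem split (h : Trail P a b) {w : α} (hw : ∃ q ∈ P, w ∈ q.2) :
    ∃ P₁ P₂, P = P₁ + P₂ ∧ Trail P₁ a w ∧ Trail P₂ w b := by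
  induction h with
  | nil => simp at hw
  | @cons P a b c e hab h ih =>
    by_cases hwa : w = a
    · subst hwa
      exact ⟨0, _, (zero_add _).symm, nil w, cons e hab h⟩
    by_cases hwb : w = b
    · subst hwb
      exact ⟨{(e, s(a, w))}, P, rfl, single e hab, h⟩
    obtain ⟨q, hq, hwq⟩ := hw
    rcases Multiset.mem_cons.1 hq with rfl | hq
    · simp [hwa, hwb] at hwq
    · obtain ⟨P₁, P₂, rfl, h₁, h₂⟩ := ih ⟨q, hq, hwq⟩
      exact ⟨_, P₂, (Multiset.cons_add _ _ _).symm, cons e hab h₁, h₂⟩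

/-- Each passage through `w` uses two pairs, and each end of the trail at `w` uses one; the two
corrections cancel modulo 2 when `a = b`. -/
theorem even_degree (h : Trail P a b) (w : α) :
    Even (degree P w + (if w = a then 1 else 0) + if w = b then 1 else 0) := by
  induction h with
  | nil a => by_cases h : w = a <;> simp [h, degree]
  | @cons P a b c e hab h ih =>
    rw [degree_cons]
    by_cases hwa : w = a
    · subst hwa
      simp only [hab, if_false, Sym2.mem_iff, true_or, if_true] at ih ⊢
      have : degree P w + 1 + 1 + (if w = c then 1 else 0)
          = (degree P w + 0 + (if w = c then 1 else 0)) + 2 := by ring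
      rw [this]
      exact ih.add even_two
    · by_cases hwb : w = b
      · subst hwb
        simpa [hwa] using ih
      · simpa [hwa, hwb] using ih

/-- Extend a trail in a multigraph with even degrees until it closes up. -/
theorem exists_closed {R : Multiset (Finset α × Sym2 α)} (hR : IsMarking R)
    (heven : ∀ w, Even (degree R w)) :
    ∀ (n : ℕ) {P : Multiset (Finset α × Sym2 α)} {b : α}, Trail P a b → P ≤ R →
      R.card - P.card = n → ∃ Q ≤ R, P ≤ Q ∧ Trail Q a a := by
  intro n
  induction n using Nat.strong_induction_on with
  | _ n ih =>
    intro P b h hP hn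
    by_cases hab : b = a
    · subst hab; exact ⟨P, hP, le_rfl, h⟩
    -- The open end `b` has odd degree in `P` but even degree in `R`, so an unused pair leaves `b`.
    have hodd := h.even_degree b
    simp only [hab, if_false, if_true, add_zero] at hodd
    have hpos : 0 < degree (R - P) b := by
      by_contra h0
      have h1 : degree R b = degree P b + degree (R - P) b := by
        rw [← degree_add, add_tsub_cancel_of_le hP]
      have := heven b
      rw [h1, show degree (R - P) b = 0 by omega] at this
      rw [Nat.even_add_one] at hodd
      exact hodd (by simpa using this)
    obtain ⟨⟨e, s⟩, hq, hbs⟩ := Multiset.countP_pos.1 hpos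
    obtain ⟨c, rfl⟩ := Sym2.mem_iff_exists.1 hbs
    have hqR : (e, s(b, c)) ∈ R := Multiset.mem_of_le tsub_le_self hq
    have hbc : b ≠ c := by simpa using (hR _ hqR).1
    have hle : P + {(e, s(b, c))} ≤ R := by
      rw [← add_tsub_cancel_of_le hP]
      exact add_le_add_right (Multiset.singleton_le.2 hq) P
    have hcard := Multiset.card_le_card hle
    rw [Multiset.card_add, Multiset.card_singleton] at hcard
    obtain ⟨Q, hQ, hPQ, hT⟩ := ih (R.card - (P + {(e, s(b, c))}).card)
      (by rw [Multiset.card_add, Multiset.card_singleton]; omega)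
      (h.append (single e hbc)) hle rfl
    exact ⟨Q, hQ, (Multiset.le_add_right _ _).trans hPQ, hT⟩

/-- Euler's theorem, starting from a closed trail. -/
theorem exists_euler {R : Multiset (Finset α × Sym2 α)} (hR : IsMarking R)
    (heven : ∀ w, Even (degree R w))
    (hconn : ∀ q ∈ R, ∀ w ∈ q.2, ∀ X : Set α, a ∈ X → IsClosedUnder X R → w ∈ X) :
    ∀ (n : ℕ) {P : Multiset (Finset α × Sym2 α)}, Trail P a a → P ≤ R →
      R.card - P.card = n → Trail R a a := by
  intro n
  induction n using Nat.strong_induction_on with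
  | _ n ih =>
    intro P h hP hn
    by_cases hRP : P = R
    · exact hRP ▸ h
    have hadd : P + (R - P) = R := add_tsub_cancel_of_le hP
    have hne : R - P ≠ 0 := fun h0 => hRP (by rw [← hadd, h0, add_zero])
    -- Otherwise the vertices touched by the trail would form a closed set containing `a` and
    -- missing an unused pair.
    have htouch : ∃ q ∈ R - P, ∃ w ∈ q.2, w = a ∨ ∃ p ∈ P, w ∈ p.2 := by
      by_contra! hcon
      obtain ⟨q, hq⟩ := Multiset.exists_mem_of_ne_zero hne
      have hqR : q ∈ R := Multiset.mem_of_le tsub_le_self hq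
      have hX : IsClosedUnder {w | w = a ∨ ∃ p ∈ P, w ∈ p.2} R := by
        intro r hr x hx hxX y hy
        rw [← hadd, Multiset.mem_add] at hr
        rcases hr with hr | hr
        · exact Or.inr ⟨r, hr, hy⟩
        · rcases hxX with h1 | ⟨p, hp, hxp⟩
          · exact absurd h1 (hcon r hr x hx).1
          · exact absurd hxp ((hcon r hr x hx).2 p hp)
      have hw := Sym2.out_fst_mem q.2
      rcases hconn q hqR _ hw _ (Or.inl rfl) hX with h1 | ⟨p, hp, hxp⟩
      · exact (hcon q hq _ hw).1 h1
      · exact (hcon q hq _ hw).2 p hp hxp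
    obtain ⟨⟨e, s⟩, hq, w, hws, hwP⟩ := htouch
    obtain ⟨c, rfl⟩ := Sym2.mem_iff_exists.1 hws
    have hR' : IsMarking (R - P) := fun q hq => hR q (Multiset.mem_of_le tsub_le_self hq)
    have hwc : w ≠ c := by simpa using (hR' _ hq).1
    have heven' : ∀ z, Even (degree (R - P) z) := by
      intro z
      have h1 : degree R z = degree P z + degree (R - P) z := by rw [← degree_add, hadd]
      have h2 : Even (degree P z) := by
        have := h.even_degree z
        by_cases hz : z = a
        · simpa [hz, Nat.even_add] using this
        · simpa [hz] using this
      have h3 := heven z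
      rw [h1, Nat.even_add] at h3
      exact h3.1 h2
    obtain ⟨Q, hQ, hqQ, hT⟩ := exists_closed hR' heven' _ (single e hwc)
      (Multiset.singleton_le.2 hq) rfl
    have hQcard : 1 ≤ Q.card := by simpa using Multiset.card_le_card hqQ
    have hle : P + Q ≤ R := hadd ▸ add_le_add_right hQ P
    have hcard := Multiset.card_le_card hle
    rw [Multiset.card_add] at hcard
    refine ih (R.card - (P + Q).card) (by rw [Multiset.card_add]; omega) ?_ hle rfl
    by_cases hwa : w = a
    · subst hwa
      exact h.append hT
    -- The new closed trail is spliced into the old one at `w`.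
    · obtain ⟨P₁, P₂, rfl, h₁, h₂⟩ := h.split (hwP.resolve_left hwa)
      rw [add_right_comm]
      exact (h₁.append hT).append h₂

end Trail

theorem hasSpanningEulerTour_iff_marking {H : MultiHypergraph α} {u v : α} (huv : u ≠ v)
    (hu : u ∈ H.verts) (hv : v ∈ H.verts) :
    H.HasSpanningEulerTour ↔ ∃ P, P.map Prod.fst = H.edges ∧ IsMarking P ∧
      (∀ w, Even (degree P w)) ∧
      ∀ w ∈ H.verts, ∀ X : Set α, u ∈ X → IsClosedUnder X P → w ∈ X := by
  constructor
  · rintro ⟨x, W, ⟨-, hT, hE⟩, hspan⟩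
    obtain ⟨P, hP, hm, hM, hX⟩ := W.exists_trail
    refine ⟨P, hm.trans (le_antisymm hT hE), hM, fun w => ?_, fun w hw X huX hXP => ?_⟩
    · have := hP.even_degree w
      by_cases hz : w = x
      · simpa [hz, Nat.even_add] using this
      · simpa [hz] using this
    · exact (hX X hXP w (hspan w hw)).2 ((hX X hXP u (hspan u hu)).1 huX)
  · rintro ⟨P, hm, hM, heven, hconn⟩
    have hE : ∀ q ∈ P, q.1 ∈ H.edges := fun q hq => hm ▸ Multiset.mem_map_of_mem _ hq
    have hT : Trail P u u := Trail.exists_euler hM heven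
      (fun q hq w hw => hconn w (H.subset_verts _ (hE q hq) ((hM q hq).2 w hw))) _
      (Trail.nil u) (Multiset.zero_le _) rfl
    obtain ⟨W, h1, h2, h3⟩ := hT.exists_walk hu hM hE
    have hspan : ∀ y ∈ H.verts, y ∈ W.anchors := by
      intro y hy
      refine hconn y hy {w | w ∈ W.anchors} h2 ?_
      exact fun q hq _ _ _ z hz => h3 q hq z hz
    refine ⟨u, W, ⟨?_, (h1.trans hm).le, (h1.trans hm).ge⟩, hspan⟩
    clear h1 h2 h3
    -- The length is at least 2: the anchor `v ≠ u` excludes length 0, and distinctness of adjacent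
    -- vertices excludes a closed walk of length 1.
    cases W with
    | nil _ _ => exact absurd (by simpa [Walk.anchors] using hspan v hv) huv.symm
    | cons e he W =>
      cases W with
      | nil _ _ => exact absurd rfl he.2.1
      | cons e' he' W => simp [Walk.length, Walk.edgeList]

end MultiHypergraph

/-! ### Splitting a marking along the pair `u`, `v`. -/

namespace MultiHypergraph

variable {α : Type*} [DecidableEq α]

theorem IsMarking.mem_iff {P : Multiset (Finset α × Sym2 α)} (hP : IsMarking P) {u v : α}
    {q : Finset α × Sym2 α} (hq : q ∈ P) (h : q.1 ⊆ {u, v}) {w : α} :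
    w ∈ q.2 ↔ w = u ∨ w = v := by
  obtain ⟨hd, hin⟩ := hP q hq
  obtain ⟨e, s⟩ := q
  induction s using Sym2.ind with
  | _ x y =>
    have hx := h (hin x (Sym2.mem_mk_left x y))
    have hy := h (hin y (Sym2.mem_mk_right x y))
    simp only [Sym2.mk_isDiag_iff, Finset.mem_insert, Finset.mem_singleton] at hd hx hy
    rw [Sym2.mem_iff]
    rcases hx with rfl | rfl <;> rcases hy with rfl | rfl
    · exact absurd rfl hd
    · rfl
    · exact or_comm
    · exact absurd rfl hd

theorem IsMarking.eq_of_subset {P : Multiset (Finset α × Sym2 α)} (hP : IsMarking P) {u v : α}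
    {q : Finset α × Sym2 α} (hq : q ∈ P) (h : q.1 ⊆ {u, v}) : q.1 = {u, v} := by
  refine h.antisymm fun w hw => (hP q hq).2 w ((hP.mem_iff hq h).2 ?_)
  simpa using hw

/-- `Q` marks the edges in `E` in such a way that, together with `m` edges joining `u` and `v`,
the marks form a connected multigraph with even degrees on the vertex set `A`. -/
structure IsSplitting (E : Multiset (Finset α)) (A : Finset α) (m : ℕ) (u v : α)
    (Q : Multiset (Finset α × Sym2 α)) : Prop where
  map_fst : Q.map Prod.fst = E
  isMarking : IsMarking Q
  even_degree : ∀ w, w ≠ u → w ≠ v → Even (degree Q w)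
  even_left : Even (degree Q u + m)
  even_right : Even (degree Q v + m)
  mem_of_mem : ∀ w ∈ A, ∀ X : Set α, u ∈ X → v ∈ X → IsClosedUnder X Q → w ∈ X
  link : m = 0 → ∀ X : Set α, u ∈ X → IsClosedUnder X Q → v ∈ X

/-- The `m` forced marks `uv` add `m` to the degrees at `u` and `v` and join them as soon as `m >
0`; this is why `link` is required only for `m = 0`. -/
theorem hasSpanningEulerTour_iff_splitting {H : MultiHypergraph α} {u v : α} (huv : u ≠ v)
    (hu : u ∈ H.verts) (hv : v ∈ H.verts) :
    H.HasSpanningEulerTour ↔ ∃ Q, IsSplitting (H.edges.filter (fun e => e ≠ {u, v})) H.verts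
      (H.edges.count {u, v}) u v Q := by
  rw [hasSpanningEulerTour_iff_marking huv hu hv]
  constructor
  · rintro ⟨P, hm, hM, heven, hconn⟩
    set R := P.filter (fun q => q.1 = {u, v}) with hR
    set Q := P.filter (fun q => ¬ q.1 = {u, v}) with hQ
    have hadd : R + Q = P := Multiset.filter_add_not _ P
    have hRmem : ∀ q ∈ R, ∀ w, w ∈ q.2 ↔ w = u ∨ w = v := fun q hq w =>
      hM.mem_iff (Multiset.mem_filter.1 hq).1 (Multiset.mem_filter.1 hq).2.subset
    have hRcard : R.card = H.edges.count {u, v} := by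
      rw [← hm, hR, Multiset.count_map]
      simp only [eq_comm]
    have hdeg : ∀ w, degree P w = degree R w + degree Q w := fun w => by rw [← hadd, degree_add]
    have hRdeg : ∀ w, w = u ∨ w = v → degree R w = H.edges.count {u, v} := fun w hw => by
      rw [← hRcard]
      exact Multiset.countP_eq_card.2 fun q hq => (hRmem q hq w).2 hw
    have hclosed : ∀ X : Set α, (R ≠ 0 → (u ∈ X ↔ v ∈ X)) → IsClosedUnder X Q →
        IsClosedUnder X P := by
      intro X huvX hX q hq
      rw [← hadd, Multiset.mem_add] at hq
      rcases hq with hq | hq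
      · have := huvX (by rintro h0; simp [h0] at hq)
        intro x hx hxX y hy
        rcases (hRmem q hq x).1 hx with rfl | rfl <;> rcases (hRmem q hq y).1 hy with rfl | rfl <;>
          simp_all
      · exact hX q hq
    refine ⟨Q, ?_, hM.mono fun q hq => (Multiset.mem_filter.1 hq).1, ?_, ?_, ?_, ?_, ?_⟩
    · rw [← hm, Multiset.filter_map]; rfl
    · intro w hwu hwv
      have := heven w
      rwa [hdeg, degree_eq_zero (P := R), zero_add] at this
      intro q hq h
      rcases (hRmem q hq w).1 h with h | h <;> contradiction
    · have := heven u
      rwa [hdeg, hRdeg u (Or.inl rfl), add_comm] at this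
    · have := heven v
      rwa [hdeg, hRdeg v (Or.inr rfl), add_comm] at this
    · exact fun w hw X huX hvX hX => hconn w hw X huX (hclosed X (fun _ => iff_of_true huX hvX) hX)
    · intro h0 X huX hX
      refine hconn v hv X huX (hclosed X (fun hne => absurd ?_ hne) hX)
      rw [← Multiset.card_eq_zero, hRcard, h0]
  · rintro ⟨Q, hQ⟩
    set m := H.edges.count {u, v} with hm
    have hdeg : ∀ w, degree (Multiset.replicate m (({u, v} : Finset α), s(u, v))) w =
        if w = u ∨ w = v then m else 0 := by
      intro w
      split_ifs with h
      · conv_rhs => rw [← Multiset.card_replicate m (({u, v} : Finset α), s(u, v))]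
        refine Multiset.countP_eq_card.2 fun q hq => ?_
        rw [Multiset.eq_of_mem_replicate hq]
        simpa using h
      · refine degree_eq_zero fun q hq => ?_
        rw [Multiset.eq_of_mem_replicate hq]
        simpa using h
    refine ⟨Multiset.replicate m ({u, v}, s(u, v)) + Q, ?_, ?_, ?_, ?_⟩
    · rw [Multiset.map_add, hQ.map_fst, Multiset.map_replicate, hm, ← Multiset.filter_eq']
      exact Multiset.filter_add_not _ _
    · intro q hq
      rcases Multiset.mem_add.1 hq with hq | hq
      · rw [Multiset.eq_of_mem_replicate hq]
        simp [huv]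
      · exact hQ.isMarking q hq
    · intro w
      rw [degree_add, hdeg, add_comm]
      split_ifs with h
      · rcases h with rfl | rfl
        exacts [hQ.even_left, hQ.even_right]
      · rw [not_or] at h
        exact hQ.even_degree w h.1 h.2
    · intro w hw X huX hX
      have hXQ : IsClosedUnder X Q := hX.mono fun q hq => Multiset.mem_add.2 (Or.inr hq)
      refine hQ.mem_of_mem w hw X huX ?_ hXQ
      by_cases h0 : m = 0
      · exact hQ.link h0 X huX hXQ
      · exact hX ({u, v}, s(u, v))
          (Multiset.mem_add.2 (Or.inl (Multiset.mem_replicate.2 ⟨h0, rfl⟩)))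
          u (Sym2.mem_mk_left u v) huX v (Sym2.mem_mk_right u v)

theorem sum_filter_of_existsUnique {ι β : Type*} [Fintype ι] [DecidableEq β] (p : ι → β → Prop)
    [∀ i, DecidablePred (p i)] {M : Multiset β} (h : ∀ a ∈ M, ∃! i, p i a) :
    ∑ i, M.filter (p i) = M := by
  ext a
  rw [Multiset.count_sum']
  simp only [Multiset.count_filter]
  by_cases ha : a ∈ M
  · obtain ⟨i, hi, huniq⟩ := h a ha
    rw [Finset.sum_eq_single i, if_pos hi]
    · exact fun j _ hj => if_neg fun hpj => hj (huniq j hpj)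
    · simp
  · simp [Multiset.count_eq_zero_of_notMem ha]

/-- The combinatorial core: restrict a marking to the pieces, or add up markings of the pieces,
tracking parity at `u` and `v` and whether some piece joins them. -/
theorem exists_splitting_iff {ι : Type*} [Fintype ι] [DecidableEq ι] [Nonempty ι]
    {E : Multiset (Finset α)} {A : Finset α} {m : ℕ} {u v : α} (huv : u ≠ v) (hm : Even m)
    (V : ι → Finset α) (hVA : ∀ i, V i ⊆ A) (huV : ∀ i, u ∉ V i) (hvV : ∀ i, v ∉ V i)
    (hdisj : ∀ i j x, x ∈ V i → x ∈ V j → i = j)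
    (hcov : ∀ x ∈ A, x ≠ u → x ≠ v → ∃ i, x ∈ V i)
    (hES : ∀ e ∈ E, e ≠ {u, v})
    (hE : ∀ e ∈ E, e ⊆ {u, v} ∨ ∃ i, e ⊆ V i ∪ {u, v} ∧ ∃ x ∈ e, x ∈ V i) :
    (∃ Q, IsSplitting E A m u v Q) ↔
      ∃ I : Finset ι, Even I.card ∧
        (∀ i ∈ I, ∃ Q, IsSplitting (E.filter (fun e => e ⊆ V i ∪ {u, v})) (V i ∪ {u, v})
          (m + 1) u v Q) ∧
        (∀ i, i ∉ I →
          (∃ Q, IsSplitting (E.filter (fun e => e ⊆ V i ∪ {u, v})) (V i ∪ {u, v}) m u v Q) ∨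
          ∃ Q, IsSplitting (E.filter (fun e => e ⊆ V i ∪ {u, v})) (V i ∪ {u, v})
            (m + 2) u v Q) ∧
        (I = ∅ → ∃ i, ∃ Q, IsSplitting (E.filter (fun e => e ⊆ V i ∪ {u, v})) (V i ∪ {u, v})
            m u v Q) := by
  have hpart : (∀ e ∈ E, ¬ e ⊆ {u, v}) → ∀ e ∈ E, ∃! i, e ⊆ V i ∪ {u, v} := by
    intro hsub e he
    obtain ⟨i, hi, x, hxe, hxi⟩ := (hE e he).resolve_left (hsub e he)
    refine ⟨i, hi, fun j hj => hdisj j i x ?_ hxi⟩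
    have := hj hxe
    simp only [Finset.mem_union, Finset.mem_insert, Finset.mem_singleton] at this
    rcases this with h | rfl | rfl
    · exact h
    · exact absurd hxi (huV i)
    · exact absurd hxi (hvV i)
  have hmemV : ∀ i x, x ∈ V i ∪ {u, v} ↔ x ∈ V i ∨ x = u ∨ x = v := by
    simp only [Finset.mem_union, Finset.mem_insert, Finset.mem_singleton, implies_true]
  have hloc : ∀ {i : ι} {Q : Multiset (Finset α × Sym2 α)}, IsMarking Q →
      (∀ q ∈ Q, q.1 ⊆ V i ∪ {u, v}) → ∀ q ∈ Q, ∀ x ∈ q.2, x ∈ V i ∨ x = u ∨ x = v := by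
    intro i Q hQ hsub q hq x hx
    exact (hmemV i x).1 (hsub q hq ((hQ q hq).2 x hx))
  constructor
  · rintro ⟨Q, hQ⟩
    have hsub : ∀ e ∈ E, ¬ e ⊆ {u, v} := by
      intro e he h
      obtain ⟨q, hq, rfl⟩ := Multiset.mem_map.1 (hQ.map_fst ▸ he)
      exact hES _ he (hQ.isMarking.eq_of_subset hq h)
    set R : ι → Multiset (Finset α × Sym2 α) :=
      fun i => Q.filter (fun q => q.1 ⊆ V i ∪ {u, v}) with hR
    have hRsum : ∑ i, R i = Q := sum_filter_of_existsUnique _ fun q hq =>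
      hpart hsub q.1 (hQ.map_fst ▸ Multiset.mem_map_of_mem _ hq)
    have hRQ : ∀ i, ∀ q ∈ R i, q ∈ Q := fun i q hq => (Multiset.mem_filter.1 hq).1
    have hRM : ∀ i, IsMarking (R i) := fun i => hQ.isMarking.mono (hRQ i)
    have hRloc : ∀ i, ∀ q ∈ R i, ∀ x ∈ q.2, x ∈ V i ∨ x = u ∨ x = v := fun i =>
      hloc (hRM i) fun q hq => (Multiset.mem_filter.1 hq).2
    have hmem : ∀ q ∈ Q, ∃ i, q ∈ R i := by
      intro q hq
      rw [← hRsum, Multiset.mem_sum] at hq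
      obtain ⟨i, -, hi⟩ := hq
      exact ⟨i, hi⟩
    have hdeg : ∀ w, degree Q w = ∑ i, degree (R i) w := fun w => by
      rw [← degree_sum, hRsum]
    have heven : ∀ i w, w ≠ u → w ≠ v → Even (degree (R i) w) := by
      intro i w hwu hwv
      by_cases hw : w ∈ V i
      · have := hQ.even_degree w hwu hwv
        rwa [hdeg, Finset.sum_eq_single i _ (by simp)] at this
        intro j _ hj
        refine degree_eq_zero fun q hq hwq => ?_
        rcases hRloc j q hq w hwq with h | h | h
        exacts [hj (hdisj j i w h hw), hwu h, hwv h]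
      · rw [degree_eq_zero]
        · exact Even.zero
        · intro q hq hwq
          rcases hRloc i q hq w hwq with h | h | h
          exacts [hw h, hwu h, hwv h]
    have hshake : ∀ i, Even (degree (R i) u + degree (R i) v) := by
      intro i
      have h1 : Even (∑ w ∈ V i ∪ {u, v}, degree (R i) w) := by
        refine even_sum_degree (hRM i) fun q hq _ _ _ y hy => ?_
        exact (hmemV i y).2 (hRloc i q hq y hy)
      rw [Finset.sum_union (by simp [huV i, hvV i]), Finset.sum_pair huv, Nat.even_add] at h1
      refine h1.1 (Finset.even_sum _ fun w hw => heven i w ?_ ?_)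
      · rintro rfl; exact huV i hw
      · rintro rfl; exact hvV i hw
    have hpiece : ∀ i n, Even (degree (R i) u + n) →
        (m + n = 0 → ∀ X : Set α, u ∈ X → IsClosedUnder X (R i) → v ∈ X) →
        IsSplitting (E.filter (fun e => e ⊆ V i ∪ {u, v})) (V i ∪ {u, v}) (m + n) u v (R i) := by
      intro i n hn hlink
      have hleft : Even (degree (R i) u + (m + n)) := by
        rw [add_left_comm]; exact hm.add hn
      refine ⟨?_, hRM i, heven i, hleft, ?_, ?_, hlink⟩
      · rw [← hQ.map_fst, Multiset.filter_map]; rfl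
      · have := hshake i
        grind
      · intro w hw X huX hvX hX
        have hV : w ∈ V i → w ∈ X := by
          intro hwV
          -- Enlarging `X` by everything outside `V i` makes it closed under all of `Q`, since
          -- pieces share only `u` and `v`.
          refine hQ.mem_of_mem w (hVA i hwV) {z | z ∈ V i → z ∈ X} (fun _ => huX) (fun _ => hvX)
            ?_ hwV
          intro q hq x hx hxX y hy hyV
          obtain ⟨j, hj⟩ := hmem q hq
          have hij : j = i := by
            rcases hRloc j q hj y hy with h | rfl | rfl
            exacts [hdisj j i y h hyV, absurd hyV (huV i), absurd hyV (hvV i)]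
          subst hij
          refine hX q hj x hx ?_ y hy
          rcases hRloc j q hj x hx with h | rfl | rfl
          exacts [hxX h, huX, hvX]
        simp only [Finset.mem_union, Finset.mem_insert, Finset.mem_singleton] at hw
        rcases hw with h | rfl | rfl
        exacts [hV h, huX, hvX]
    refine ⟨Finset.univ.filter (fun i => Odd (degree (R i) u)), ?_, ?_, ?_, ?_⟩
    · rw [← Finset.even_sum_iff_even_card_odd, ← hdeg]
      exact (Nat.even_add.1 hQ.even_left).2 hm
    · intro i hi
      exact ⟨R i, hpiece i 1 (Finset.mem_filter.1 hi).2.add_one (by simp)⟩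
    · intro i hi
      have : Even (degree (R i) u) := by simpa using hi
      -- Two extra copies keep the parity and make `link` vacuous.
      exact Or.inr ⟨R i, hpiece i 2 (this.add even_two) (by simp)⟩
    · intro hI
      have hev : ∀ i, Even (degree (R i) u) := by
        intro i
        have : i ∉ Finset.univ.filter (fun i => Odd (degree (R i) u)) := by simp [hI]
        simpa using this
      by_contra! hcon
      have hm0 : m = 0 := by
        by_contra h0
        obtain ⟨i⟩ := ‹Nonempty ι›
        exact hcon i _ (hpiece i 0 (hev i) fun h => absurd h h0)
      have hX : ∀ i, ∃ X : Set α, u ∈ X ∧ IsClosedUnder X (R i) ∧ v ∉ X := by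
        intro i
        by_contra! hno
        exact hcon i _ (hpiece i 0 (hev i) fun _ X h1 h2 => hno X h1 h2)
      choose X huX hX hvX using hX
      -- If every piece separates `u` from `v`, the separating sets glue along `u` to one that is
      -- closed under `Q` and misses `v`.
      have hv : v ∈ {z | z = u ∨ ∃ i, z ∈ V i ∧ z ∈ X i} := by
        refine hQ.link hm0 _ (Or.inl rfl) fun q hq x hx hxX y hy => ?_
        obtain ⟨j, hj⟩ := hmem q hq
        have hxXj : x ∈ X j := by
          rcases hxX with rfl | ⟨i, hi, hiX⟩
          · exact huX j
          · rcases hRloc j q hj x hx with h | rfl | rfl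
            · exact hdisj i j x hi h ▸ hiX
            · exact huX j
            · exact absurd hi (hvV i)
        have hyX := hX j q hj x hx hxXj y hy
        rcases hRloc j q hj y hy with h | h | rfl
        · exact Or.inr ⟨j, h, hyX⟩
        · exact Or.inl h
        · exact absurd hyX (hvX j)
      rcases hv with h | ⟨i, hi, -⟩
      · exact huv h.symm
      · exact hvV i hi
  · rintro ⟨I, hI, h1, h2, h3⟩
    classical
    have hn : ∃ n : ι → ℕ, (∀ i, ∃ Q, IsSplitting (E.filter (fun e => e ⊆ V i ∪ {u, v}))
        (V i ∪ {u, v}) (m + n i) u v Q) ∧ (∀ i, Odd (n i) ↔ i ∈ I) ∧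
        (I = ∅ → ∃ i, n i = 0) := by
      -- `n i` is the number of extra copies of `S` in piece `i`; choosing 0 over 2 whenever
      -- possible lets condition (3) supply a piece with `n i = 0`.
      refine ⟨fun i => if i ∈ I then 1 else if ∃ Q, IsSplitting
        (E.filter (fun e => e ⊆ V i ∪ {u, v})) (V i ∪ {u, v}) m u v Q then 0 else 2, ?_, ?_, ?_⟩
      · intro i
        dsimp only
        split_ifs with hi h
        exacts [h1 i hi, h, (h2 i hi).resolve_left h]
      · intro i
        dsimp only
        split_ifs with hi h <;> simp [hi]
      · intro h0
        obtain ⟨i, hi⟩ := h3 h0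
        exact ⟨i, (if_neg (by simp [h0])).trans (if_pos hi)⟩
    obtain ⟨n, hn, hodd, hzero⟩ := hn
    choose R hR using hn
    -- An edge inside `{u, v}` belongs to every piece, and there is at least one, where its mark
    -- would force it to equal `{u, v}`.
    have hsub : ∀ e ∈ E, ¬ e ⊆ {u, v} := by
      intro e he h
      obtain ⟨i⟩ := ‹Nonempty ι›
      have hei : e ∈ (R i).map Prod.fst := by
        rw [(hR i).map_fst]
        exact Multiset.mem_filter.2 ⟨he, h.trans Finset.subset_union_right⟩
      obtain ⟨q, hq, rfl⟩ := Multiset.mem_map.1 hei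
      exact hES _ he ((hR i).isMarking.eq_of_subset hq h)
    have hRloc : ∀ i, ∀ q ∈ R i, ∀ x ∈ q.2, x ∈ V i ∨ x = u ∨ x = v := fun i =>
      hloc (hR i).isMarking fun q hq => by
        have := Multiset.mem_map_of_mem Prod.fst hq
        rw [(hR i).map_fst] at this
        exact (Multiset.mem_filter.1 this).2
    have hRmem : ∀ i, ∀ q ∈ R i, q ∈ ∑ i, R i := fun i q hq =>
      Multiset.mem_sum.2 ⟨i, Finset.mem_univ i, hq⟩
    have hIsum : Even (∑ i, n i) := by
      rw [Finset.even_sum_iff_even_card_odd]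
      simpa [hodd] using hI
    have hend : ∀ w, (∀ i, Even (degree (R i) w + (m + n i))) →
        Even (degree (∑ i, R i) w + m) := by
      intro w hw
      refine Even.add ?_ hm
      have h4 : Even (∑ i, (degree (R i) w + n i)) := by
        refine Finset.even_sum _ fun i _ => ?_
        have := hw i
        grind
      rw [Finset.sum_add_distrib, ← degree_sum] at h4
      exact (Nat.even_add.1 h4).2 hIsum
    refine ⟨∑ i, R i, ?_, ?_, ?_, hend u fun i => (hR i).even_left,
      hend v fun i => (hR i).even_right, ?_, ?_⟩
    · rw [← Multiset.coe_mapAddMonoidHom, map_sum]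
      simp only [Multiset.coe_mapAddMonoidHom, (hR _).map_fst]
      exact sum_filter_of_existsUnique _ (hpart hsub)
    · intro q hq
      obtain ⟨i, -, hi⟩ := Multiset.mem_sum.1 hq
      exact (hR i).isMarking q hi
    · intro w hwu hwv
      rw [degree_sum]
      exact Finset.even_sum _ fun i _ => (hR i).even_degree w hwu hwv
    · intro w hw X huX hvX hX
      by_cases hwu : w = u
      · exact hwu ▸ huX
      by_cases hwv : w = v
      · exact hwv ▸ hvX
      obtain ⟨i, hi⟩ := hcov w hw hwu hwv
      exact (hR i).mem_of_mem w (Finset.mem_union_left _ hi) X huX hvX (hX.mono (hRmem i))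
    · intro hm0 X huX hX
      rcases I.eq_empty_or_nonempty with h0 | ⟨i, hi⟩
      · obtain ⟨i, hi⟩ := hzero h0
        exact (hR i).link (by rw [hm0, hi]) X huX (hX.mono (hRmem i))
      -- In an odd piece the handshake lemma on the part of `X` there, which contains `u` but not
      -- `v`, makes the degree at `u` even, a contradiction.
      · by_contra hvX
        have hXi := hX.mono (hRmem i)
        have hu : u ∈ (V i ∪ {u, v}).filter (· ∈ X) := by simp [huX]
        have h4 := even_sum_degree (A := (V i ∪ {u, v}).filter (· ∈ X)) (hR i).isMarking (by
          intro q hq x hx hxX y hy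
          have hy' := hRloc i q hq y hy
          have hyX := hXi q hq x hx (Finset.mem_filter.1 hxX).2 y hy
          exact Finset.mem_filter.2 ⟨(hmemV i y).2 hy', hyX⟩)
        rw [← Finset.add_sum_erase _ _ hu, Nat.even_add] at h4
        have h5 : Even (degree (R i) u) := by
          refine h4.2 (Finset.even_sum _ fun w hw => ?_)
          obtain ⟨hwu, hw⟩ := Finset.mem_erase.1 hw
          refine (hR i).even_degree w hwu ?_
          rintro rfl
          exact hvX (Finset.mem_filter.1 hw).2
        have h6 := (hR i).even_left
        have h7 := (hodd i).2 hi
        rw [hm0, zero_add, Nat.even_add] at h6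
        exact Nat.not_even_iff_odd.2 h7 (h6.1 h5)

theorem sComponent_eq_adjoin (H : MultiHypergraph α) (S : Finset α) (F : MultiHypergraph α) :
    H.sComponent S F = (H.sComponent S F).adjoin S 0 Finset.subset_union_right := by
  ext1 <;> simp [adjoin]

theorem adjoin_sComponent_hasSpanningEulerTour_iff {H F : MultiHypergraph α} (hempty : ∅ ∉ H.edges)
    {u v : α} (huv : u ≠ v) (n : ℕ) :
    ((H.sComponent {u, v} F).adjoin {u, v} n Finset.subset_union_right).HasSpanningEulerTour ↔
      ∃ Q, IsSplitting ((H.edges.filter (fun e => e ≠ {u, v})).filter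
        (fun e => e ⊆ F.verts ∪ {u, v})) (F.verts ∪ {u, v}) (H.edges.count {u, v} + n) u v Q := by
  rw [hasSpanningEulerTour_iff_splitting huv (by simp [adjoin, sComponent])
    (by simp [adjoin, sComponent])]
  have h1 : ((H.sComponent {u, v} F).adjoin {u, v} n Finset.subset_union_right).edges.filter
      (fun e => e ≠ {u, v}) = (H.edges.filter (fun e => e ≠ {u, v})).filter
        (fun e => e ⊆ F.verts ∪ {u, v}) := by
    have h0 : (Multiset.replicate n ({u, v} : Finset α)).filter (fun e => e ≠ {u, v}) = 0 :=
      Multiset.filter_eq_nil.2 fun e he => by simp [Multiset.eq_of_mem_replicate he]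
    simp only [adjoin, sComponent]
    rw [Multiset.filter_add, h0, add_zero, Multiset.filter_filter, Multiset.filter_filter]
    refine Multiset.filter_congr fun e he => ?_
    have : e ≠ ∅ := by rintro rfl; exact hempty he
    tauto
  have h2 : ((H.sComponent {u, v} F).adjoin {u, v} n Finset.subset_union_right).edges.count {u, v}
      = H.edges.count {u, v} + n := by
    simp only [adjoin, sComponent]
    rw [Multiset.count_add, Multiset.count_replicate_self, Multiset.count_filter_of_pos]
    exact ⟨Finset.subset_union_right, Finset.insert_ne_empty _ _⟩
  rw [h1, h2]
  rfl

end MultiHypergraph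

/-! ### The theorem: components of `H \ S` as pieces. -/

open MultiHypergraph in
theorem theorem3p13 {α : Type*} [DecidableEq α] (H : MultiHypergraph α)
    (hempty : ∅ ∉ H.edges) (u v : α) (huv : u ≠ v) (S : Finset α) (hS : S = {u, v})
    (hcut : H.IsVertexCut S)
    (heven : Even (Multiset.card (H.edges.filter (fun e => e = S))))
    (k : ℕ) (C : Fin k → MultiHypergraph α) (hCinj : Function.Injective C)
    (hC : ∀ F : MultiHypergraph α, F.IsComponent (H.delete S) ↔ ∃ i, C i = F) :
    H.HasSpanningEulerTour ↔
      ∃ I : Finset (Fin k), Even I.card ∧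
        (∀ i ∈ I, (H.sStarComponent S (C i)).HasSpanningEulerTour) ∧
        (∀ i, i ∉ I → (H.sComponent S (C i)).HasSpanningEulerTour ∨
          (H.sStarStarComponent S (C i)).HasSpanningEulerTour) ∧
        (I = ∅ → ∃ i, (H.sComponent S (C i)).HasSpanningEulerTour) := by
  subst hS
  set G := H.delete {u, v} with hG
  have hGempty : ∅ ∉ G.edges := fun h => (Multiset.mem_filter.1 h).2 rfl
  have hGverts : ∀ x, x ∈ G.verts ↔ x ∈ H.verts ∧ x ≠ u ∧ x ≠ v := by
    simp [hG, delete]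
  have hcomp : ∀ x ∈ G.verts, ∃ i, C i = G.componentOf x := fun x hx =>
    (hC _).1 (componentOf_isComponent hGempty hx)
  have hCG : ∀ i, (C i).verts ⊆ G.verts := fun i => ((hC _).2 ⟨i, rfl⟩).1.1.1
  have hCeq : ∀ i, ∀ x ∈ (C i).verts, C i = G.componentOf x := fun i x hx =>
    ((hC _).2 ⟨i, rfl⟩).eq_componentOf hGempty hx
  have hself : ∀ x ∈ G.verts, x ∈ (G.componentOf x).verts := fun x hx =>
    mem_componentOf_verts.2 ⟨.nil x hx⟩
  have hne : Nonempty (Fin k) := by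
    obtain ⟨x, hx, hxS⟩ := Finset.exists_of_ssubset hcut.1
    obtain ⟨i, -⟩ := hcomp x (Finset.mem_sdiff.2 ⟨hx, hxS⟩)
    exact ⟨i⟩
  have hu : u ∈ H.verts := hcut.1.1 (by simp)
  have hv : v ∈ H.verts := hcut.1.1 (by simp)
  have hm : Even (H.edges.count {u, v}) := by
    rwa [Multiset.filter_eq', Multiset.card_replicate] at heven
  rw [hasSpanningEulerTour_iff_splitting huv hu hv,
    exists_splitting_iff huv hm (fun i => (C i).verts)]
  · have h0 : ∀ i, (H.sComponent {u, v} (C i)).HasSpanningEulerTour ↔ _ := fun i =>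
      (sComponent_eq_adjoin H {u, v} (C i)).symm ▸
        adjoin_sComponent_hasSpanningEulerTour_iff hempty huv 0
    have h1 : ∀ i, (H.sStarComponent {u, v} (C i)).HasSpanningEulerTour ↔ _ := fun i =>
      adjoin_sComponent_hasSpanningEulerTour_iff hempty huv _
    have h2 : ∀ i, (H.sStarStarComponent {u, v} (C i)).HasSpanningEulerTour ↔ _ := fun i =>
      adjoin_sComponent_hasSpanningEulerTour_iff hempty huv 2
    simp only [h0, h1, h2, Finset.card_pair huv, Nat.div_self two_pos, add_zero]
  · exact fun i x hx => ((hGverts x).1 (hCG i hx)).1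
  · exact fun i hx => ((hGverts u).1 (hCG i hx)).2.1 rfl
  · exact fun i hx => ((hGverts v).1 (hCG i hx)).2.2 rfl
  · exact fun i j x hi hj => hCinj ((hCeq i x hi).trans (hCeq j x hj).symm)
  · intro x hx hxu hxv
    have hxG := (hGverts x).2 ⟨hx, hxu, hxv⟩
    obtain ⟨i, hi⟩ := hcomp x hxG
    exact ⟨i, hi ▸ hself x hxG⟩
  · exact fun e he => (Multiset.mem_filter.1 he).2
  · intro e he
    have heH := (Multiset.mem_filter.1 he).1
    by_cases hsub : e ⊆ {u, v}
    · exact Or.inl hsub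
    -- An edge not inside `S` leaves a non-empty edge of `H \ S`, which lies within a single
    -- component.
    obtain ⟨x, hxe, hxS⟩ := Finset.not_subset.1 hsub
    have hx : x ∈ e \ {u, v} := Finset.mem_sdiff.2 ⟨hxe, hxS⟩
    have heG : e \ {u, v} ∈ G.edges :=
      Multiset.mem_filter.2 ⟨Multiset.mem_map_of_mem _ heH, Finset.ne_empty_of_mem hx⟩
    have hxG := G.subset_verts _ heG hx
    obtain ⟨i, hi⟩ := hcomp x hxG
    refine Or.inr ⟨i, ?_, x, hxe, hi ▸ hself x hxG⟩
    have := subset_componentOf_of_mem_edge heG hx ⟨.nil x hxG⟩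
    rw [← hi] at this
    intro y hy
    by_cases hyS : y ∈ ({u, v} : Finset α)
    · exact Finset.mem_union_right _ hyS
    · exact Finset.mem_union_left _ (this (Finset.mem_sdiff.2 ⟨hy, hyS⟩))
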